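/- Let $d\ge 1$ and let $X=(x,\xi)$ denote the variable in $\mathbb{R}^{2d}$, $\langle X\rangle=(1+|X|^2)^{1/2}$, $\sigma((q,p),(q',p'))=p\cdot q'-p'\cdot q$. For $\mu,\delta\in\mathbb{R}$ let $\mathbb{S}^\mu_\delta$ be the set of $H\in C^\infty(\mathbb{R}^{2d})$ (complex valued) such that for every multi-index $\gamma\in\mathbb{N}^{2d}$ there is $C_\gamma$ with $|\partial^\gamma H(X)|\le C_\gamma\langle X\rangle^{\mu+\delta|\gamma|}$ for all $X$. Fix $\hbar=1$. The Moyal product of two such symbols (with $\delta<1/2$) is the oscillatory integral $$(A\circledast B)(X)=\pi^{-2d}\iint_{\mathbb{R}^{2d}\times\mathbb{R}^{2d}} e^{-2i\sigma(u,v)}A(X+u)B(X+v)\,du\,dv ,$$ i.e. the limit as $\varepsilon\searrow0$ of the same integral with $A,B$ replaced by $e^{-\varepsilon|X|^2}A(X)$, $e^{-\varepsilon|X|^2}B(X)$; it is the Weyl symbol of the product $\widehat A\,\widehat B$ of the Weyl quantizations. The Moyal bracket is $\{A,B\}_\circledast=i(A\circledast B-B\circledast A)$. With $D_x=i^{-1}\partial_x$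 put $$C_j(A,B)=\frac1{2^j}\sum_{|\alpha+\beta|=j}\frac{(-1)^{|\beta|}}{\alpha!\,\beta!}\,(D_x^\beta\partial_\xi^\alpha A)(D_x^\alpha\partial_\xi^\beta B),\qquad \{A,B\}_j=i\bigl(C_j(A,B)-C_j(B,A)\bigr),$$ let $\{A,B\}=\partial_\xi A\cdot\partial_xB-\partial_xA\cdot\partial_\xi B$ be the Poisson bracket, and for $m\in\mathbb{N}=\{0,1,2,\dots\}$ put $$\{A,B\}_{\circledast,m}=\{A,B\}+\{A,B\}_3+\cdots+\{A,B\}_{2m+1}.$$ Theorem. Let $H\in\mathbb{S}^\mu_\delta$ with $\mu\in\mathbb{R}$ and $\delta<1/2$, and let $m\in\mathbb{N}$. If $\{A,H\}_{\circledast,m}=\{A,H\}_\circledast$ for every $A$ in the Schwartz space $\mathcal{S}(\mathbb{R}^{2d})$, then $H$ is a polynomial in $X=(x,\xi)$ of degree at most $2m+2$. -/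

import Mathlib

open scoped ContDiff SchwartzMap Topology

noncomputable section

namespace Moyal

/-- The phase space `ℝ^{2d}`, with its Euclidean norm. For `X = (x, ξ)`, the position coordinate
`x_k` is `X (Sum.inl k)` and the momentum coordinate `ξ_k` is `X (Sum.inr k)`. -/
abbrev Phase (d : ℕ) : Type := EuclideanSpace ℝ (Fin d ⊕ Fin d)

/-- The symplectic form `σ((q, p), (q', p')) = p · q' - p' · q`. -/
def symp {d : ℕ} (u v : Phase d) : ℝ :=
  ∑ k : Fin d, (u (Sum.inr k) * v (Sum.inl k) - v (Sum.inr k) * u (Sum.inl k))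

/-- The partial derivative of `f` with respect to the coordinate `i` of phase space. -/
def pderiv {d : ℕ} (i : Fin d ⊕ Fin d) (f : Phase d → ℂ) : Phase d → ℂ :=
  fun X => fderiv ℝ f X (EuclideanSpace.single i 1)

/-- The derivative `∂_x^α ∂_ξ^β f` for multi-indices `α, β ∈ ℕ^d`. -/
def mderiv {d : ℕ} (α β : Fin d → ℕ) (f : Phase d → ℂ) : Phase d → ℂ :=
  (List.finRange d).foldr (fun k g => (pderiv (Sum.inl k))^[α k] g)
    ((List.finRange d).foldr (fun k g => (pderiv (Sum.inr k))^[β k] g) f)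

/-- The symbol class `S^μ_δ`: smooth functions `A` on phase space such that for all multi-indices
`γ = (α, β) ∈ ℕ^{2d}` there is a constant `C` with `|∂^γ A(X)| ≤ C ⟨X⟩^{μ + δ|γ|}` for all `X`,
where `⟨X⟩ = (1 + |X|²)^{1/2}`. -/
def IsSymbol {d : ℕ} (μ δ : ℝ) (A : Phase d → ℂ) : Prop :=
  ContDiff ℝ ∞ A ∧
    ∀ α β : Fin d → ℕ, ∃ C : ℝ, ∀ X : Phase d,
      ‖mderiv α β A X‖ ≤ C * Real.sqrt (1 + ‖X‖ ^ 2) ^ (μ + δ * ((∑ k, α k + ∑ k, β k : ℕ) : ℝ))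

/-- The Gaussian regularization `A_ε(X) = e^{-ε|X|²} A(X)`. -/
def gaussReg {d : ℕ} (ε : ℝ) (A : Phase d → ℂ) : Phase d → ℂ :=
  fun X => (Real.exp (-ε * ‖X‖ ^ 2) : ℂ) * A X

/-- The Moyal product integral with `ħ = 1`,
`π^{-2d} ∫∫ e^{-2iσ(u,v)} A(X+u) B(X+v) du dv`, for functions `A`, `B` for which it converges
absolutely. With `σ((q, p), (q', p')) = p · q' - p' · q`, this is the sign of the phase for which
`Op(A) Op(B) = Op(A ⊛ B)` holds for the Weyl quantization
`Op(A) f(x) = (2π)^{-d} ∫∫ A((x+y)/2, ξ) e^{iξ·(x-y)} f(y) dy dξ`. -/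
def moyalIntegral {d : ℕ} (A B : Phase d → ℂ) (X : Phase d) : ℂ :=
  ((Real.pi : ℂ) ^ (2 * d))⁻¹ *
    ∫ p : Phase d × Phase d,
      Complex.exp (-2 * Complex.I * (symp p.1 p.2 : ℂ)) * A (X + p.1) * B (X + p.2)

/-- The Moyal product `A ⊛ B` (with `ħ = 1`): the oscillatory integral
`π^{-2d} ∫∫ e^{-2iσ(u,v)} A(X+u) B(X+v) du dv`, that is, the limit as `ε ↘ 0` of the absolutely
convergent integrals for `A_ε` and `B_ε`. -/
def moyalProd {d : ℕ} (A B : Phase d → ℂ) (X : Phase d) : ℂ :=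
  Filter.limUnder (𝓝[>] (0 : ℝ)) (fun ε : ℝ => moyalIntegral (gaussReg ε A) (gaussReg ε B) X)

/-- The Moyal bracket `{A, B}_⊛ = i (A ⊛ B - B ⊛ A)` (with `ħ = 1`). -/
def moyalBracket {d : ℕ} (A B : Phase d → ℂ) (X : Phase d) : ℂ :=
  Complex.I * (moyalProd A B X - moyalProd B A X)

/-- The Poisson bracket `{A, B} = ∂_ξ A · ∂_x B - ∂_x A · ∂_ξ B`. -/
def poisson {d : ℕ} (A B : Phase d → ℂ) (X : Phase d) : ℂ :=
  ∑ k : Fin d,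
    (pderiv (Sum.inr k) A X * pderiv (Sum.inl k) B X -
      pderiv (Sum.inl k) A X * pderiv (Sum.inr k) B X)

/-- The operator `D_x^α ∂_ξ^β` with `D_x = i⁻¹ ∂_x`. -/
def Dderiv {d : ℕ} (α β : Fin d → ℕ) (f : Phase d → ℂ) : Phase d → ℂ :=
  fun X => (Complex.I⁻¹) ^ (∑ k, α k) * mderiv α β f X

/-- The coefficient of order `j` in the expansion of the Moyal product,
`C_j(A, B) = 2^{-j} ∑_{|α+β| = j} (-1)^{|β|} / (α! β!) (D_x^β ∂_ξ^α A) (D_x^α ∂_ξ^β B)`.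
The sum is over the functions `γ : Fin d ⊕ Fin d → ℕ` of total `j`; `α` and `β` are the two
halves of `γ`. -/
def moyalCoeff {d : ℕ} (j : ℕ) (A B : Phase d → ℂ) (X : Phase d) : ℂ :=
  ((2 : ℂ) ^ j)⁻¹ *
    ∑ γ ∈ Finset.piAntidiag (Finset.univ : Finset (Fin d ⊕ Fin d)) j,
      (-1 : ℂ) ^ (∑ k, γ (Sum.inr k)) /
          ((∏ k, ((γ (Sum.inl k)).factorial : ℂ)) * ∏ k, ((γ (Sum.inr k)).factorial : ℂ)) *
        (Dderiv (fun k => γ (Sum.inr k)) (fun k => γ (Sum.inl k)) A X *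
          Dderiv (fun k => γ (Sum.inl k)) (fun k => γ (Sum.inr k)) B X)

/-- The bracket of order `j`, `{A, B}_j = i (C_j(A, B) - C_j(B, A))` (with `ħ = 1`). -/
def orderBracket {d : ℕ} (j : ℕ) (A B : Phase d → ℂ) (X : Phase d) : ℂ :=
  Complex.I * (moyalCoeff j A B X - moyalCoeff j B A X)

/-- The semiclassical approximation of the Moyal bracket (with `ħ = 1`),
`{A, B}_{⊛,m} = {A, B} + {A, B}_3 + ⋯ + {A, B}_{2m+1}`. -/
def truncBracket {d : ℕ} (m : ℕ) (A B : Phase d → ℂ) (X : Phase d) : ℂ :=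
  poisson A B X + ∑ j ∈ Finset.Icc 1 m, orderBracket (2 * j + 1) A B X

end Moyal

end

/-! Fix `X`. As a functional of `A`, the truncated bracket at `X` is a differential operator of
order at most `2m+1`: it is the inverse Fourier transform at `X` of `P · 𝓕 A`, with `P` a polynomial
of degree at most `2m+1` depending on `X` and `H` (`isPolyFunctional_truncBracket`). In the full
bracket, integrating first over the variable of `A` produces `𝓕 A`. The two products then combine,
after `v ↦ -v` in one of them, into an integral of `e^{2iσ(X,v)} 𝓕 A(Jv/π) (H(X+v) - H(X-v))`, where
`J` is the symplectic rotation (`moyalBracket_eq_integral`). The Gaussian regularization is removed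
by dominated convergence, using the decay of `𝓕 A_ε` uniformly in `ε`. Since `𝓕 A` can be any test
function, equality of the brackets forces `H(X+v) - H(X-v) = -i P(Jv/π)` for all `v`
(`exists_symmDiff_eq_polyEval`). It remains to see that a smooth function with such symmetric
differences is a polynomial (`exists_mvPolynomial_of_symmDiff`). On a line through the origin put
`f(t) = H(tw)` and `N = 2m+2`. Differentiating `f(s+t) - f(s-t)` `N` times in `t` gives `f^(N)(s+t)
= f^(N)(s-t)`, because `N` is even; hence `f^(N)` is constant, and Taylor's formula at `0` is exact
at order `N`. -/

noncomputable section

namespace Moyal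

/-! ### Smooth functions with polynomial symmetric differences -/

section Polynomial

variable {ι : Type*}

/-- Evaluation of a complex polynomial at a real vector. -/
def polyEval (P : MvPolynomial ι ℂ) (v : EuclideanSpace ℝ ι) : ℂ :=
  MvPolynomial.eval (fun i => (v i : ℂ)) P

lemma continuous_polyEval (P : MvPolynomial ι ℂ) : Continuous (polyEval P) := by
  refine (MvPolynomial.continuous_eval P).comp ?_
  fun_prop

lemma iteratedDeriv_polynomial_eval (q : Polynomial ℂ) (n : ℕ) :
    iteratedDeriv n (fun t : ℝ => q.eval (t : ℂ)) =
      fun t : ℝ => (Polynomial.derivative^[n] q).eval (t : ℂ) := by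
  induction n generalizing q with
  | zero => simp
  | succ n ih =>
    have hd : deriv (fun t : ℝ => q.eval (t : ℂ)) =
        fun t : ℝ => (Polynomial.derivative q).eval (t : ℂ) := by
      funext t
      exact (q.hasDerivAt (t : ℂ)).comp_ofReal.deriv
    rw [iteratedDeriv_succ', hd, ih, Function.iterate_succ_apply]

/-- Restricted to the line through `w`, `P` becomes a one-variable polynomial, obtained by
substituting `w i * X` for the variables; this does not raise the degree. -/
lemma iteratedDeriv_polyEval_smul_eq_zero {P : MvPolynomial ι ℂ} {N : ℕ}
    (hP : P.totalDegree < N) (w : EuclideanSpace ℝ ι) :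
    iteratedDeriv N (fun t : ℝ => polyEval P (t • w)) = 0 := by
  set q : Polynomial ℂ :=
    MvPolynomial.aeval (fun i => Polynomial.C (w i : ℂ) * Polynomial.X) P with hq
  have hdeg : q.natDegree < N := by
    refine lt_of_le_of_lt ?_ hP
    simpa using MvPolynomial.aeval_natDegree_le (n := 1) P le_rfl
      (fun i => Polynomial.C (w i : ℂ) * Polynomial.X)
      (fun i => (Polynomial.natDegree_C_mul_le _ _).trans Polynomial.natDegree_X_le)
  have heval : (fun t : ℝ => polyEval P (t • w)) = fun t : ℝ => q.eval (t : ℂ) := by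
    funext t
    rw [hq, ← Polynomial.coe_aeval_eq_eval, ← AlgHom.comp_apply, MvPolynomial.comp_aeval,
      polyEval, ← MvPolynomial.coe_aeval_eq_eval]
    have hw : (fun i => ((t • w) i : ℂ)) = fun i =>
        Polynomial.aeval (t : ℂ) (Polynomial.C (w i : ℂ) * Polynomial.X) := by
      funext i
      simp only [PiLp.smul_apply, smul_eq_mul, Complex.ofReal_mul, map_mul, Polynomial.aeval_C,
        Polynomial.aeval_X, Algebra.algebraMap_self_apply, mul_comm]
    rw [hw]
    rfl
  rw [heval, iteratedDeriv_polynomial_eval, Polynomial.iterate_derivative_eq_zero hdeg]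
  funext t
  simp

/-- If every symmetric difference `t ↦ f (s + t) - f (s - t)` has vanishing derivative of some even
order `N`, then the derivative of order `N + 1` of `f` vanishes. -/
lemma iteratedDeriv_succ_eq_zero_of_symmDiff {f : ℝ → ℂ} (hf : ContDiff ℝ ∞ f) {N : ℕ}
    (hN : Even N)
    (h : ∀ s : ℝ, iteratedDeriv N (fun t => f (s + t) - f (s - t)) = 0) :
    iteratedDeriv (N + 1) f = 0 := by
  have hfN : ContDiff ℝ N f := hf.of_le (by exact_mod_cast le_top)
  have key : ∀ τ : ℝ, iteratedDeriv N f τ = iteratedDeriv N f 0 := by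
    intro τ
    -- With `s = t = τ/2` the two arguments `s + t` and `s - t` are `τ` and `0`. The reflection
    -- contributes the sign `(-1)^N = 1`.
    have h1 := congrFun (h (τ / 2)) (τ / 2)
    have hadd : ContDiff ℝ N fun t => f (τ / 2 + t) := hfN.comp (by fun_prop)
    have hsub : ContDiff ℝ N fun t => f (τ / 2 - t) := hfN.comp (by fun_prop)
    rw [iteratedDeriv_fun_sub hadd.contDiffAt hsub.contDiffAt, iteratedDeriv_comp_const_add,
      iteratedDeriv_comp_const_sub] at h1
    simp only [hN.neg_one_pow, one_smul, add_halves, sub_self, Pi.zero_apply] at h1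
    exact sub_eq_zero.1 h1
  rw [iteratedDeriv_succ, show iteratedDeriv N f = fun _ => iteratedDeriv N f 0 from funext key]
  funext x
  simp

/-- Taylor's formula on `[0, 1]`: the bound `C = 0` on the derivative of order `N + 1` makes the
remainder vanish. -/
lemma eq_sum_iteratedDeriv_of_iteratedDeriv_succ_eq_zero {f : ℝ → ℂ} (hf : ContDiff ℝ ∞ f) {N : ℕ}
    (h : iteratedDeriv (N + 1) f = 0) :
    f 1 = ∑ k ∈ Finset.range (N + 1), ((k.factorial : ℝ)⁻¹ : ℂ) * iteratedDeriv k f 0 := by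
  have hW : ∀ k : ℕ, ∀ y ∈ Set.Icc (0 : ℝ) 1,
      iteratedDerivWithin k f (Set.Icc 0 1) y = iteratedDeriv k f y := fun k y hy =>
    iteratedDerivWithin_eq_iteratedDeriv (uniqueDiffOn_Icc zero_lt_one)
      (hf.of_le (by exact_mod_cast le_top)).contDiffAt hy
  have h0 : (0 : ℝ) ∈ Set.Icc (0 : ℝ) 1 := by simp
  have h1 : (1 : ℝ) ∈ Set.Icc (0 : ℝ) 1 := by simp
  have hT := taylor_mean_remainder_bound (f := f) (C := 0) (n := N) zero_le_one
    (hf.of_le (by exact_mod_cast le_top)).contDiffOn h1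
    (fun y hy => by rw [hW _ y hy, h]; simp)
  rw [zero_mul, zero_div, norm_le_zero_iff, sub_eq_zero] at hT
  rw [hT, taylor_within_apply]
  refine Finset.sum_congr rfl fun k _ => ?_
  rw [hW k 0 h0]
  simp

variable [Fintype ι]

lemma iteratedDeriv_comp_smul_zero {H : EuclideanSpace ℝ ι → ℂ} (hH : ContDiff ℝ ∞ H)
    (w : EuclideanSpace ℝ ι) (k : ℕ) :
    iteratedDeriv k (fun t : ℝ => H (t • w)) 0 = iteratedFDeriv ℝ k H 0 (fun _ => w) := by
  have := ContinuousLinearMap.iteratedFDeriv_comp_right (i := k)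
    (ContinuousLinearMap.toSpanSingleton ℝ w) hH 0 (by exact_mod_cast le_top)
  rw [iteratedDeriv_eq_iteratedFDeriv]
  change iteratedFDeriv ℝ k (H ∘ (ContinuousLinearMap.toSpanSingleton ℝ w)) 0 _ = _
  rw [this]
  simp

/-- Expanding `w` in the standard basis and using multilinearity gives a sum of monomials of degree
`k`. This turns the Taylor terms of `H` at `0` into polynomials. -/
lemma exists_mvPolynomial_iteratedFDeriv (k : ℕ)
    (D : ContinuousMultilinearMap ℝ (fun _ : Fin k => EuclideanSpace ℝ ι) ℂ) :
    ∃ p : MvPolynomial ι ℂ, p.totalDegree ≤ k ∧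
      ∀ w, D (fun _ => w) = polyEval p w := by
  classical
  refine ⟨∑ r : Fin k → ι, MvPolynomial.C (D fun j => EuclideanSpace.single (r j) 1) *
    ∏ j, MvPolynomial.X (r j), ?_, fun w => ?_⟩
  · refine MvPolynomial.totalDegree_finsetSum_le fun r _ => ?_
    refine (MvPolynomial.totalDegree_mul _ _).trans ?_
    rw [MvPolynomial.totalDegree_C, zero_add]
    refine (MvPolynomial.totalDegree_finsetProd _ _).trans ?_
    simp
  · have hw : w = ∑ i, w i • EuclideanSpace.single i (1 : ℝ) := by
      simpa using ((EuclideanSpace.basisFun ι ℝ).sum_repr w).symm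
    have h1 : D (fun _ => w) = D (fun _ => ∑ i, w i • EuclideanSpace.single i (1 : ℝ)) :=
      congrArg D (funext fun _ => hw)
    rw [h1, ContinuousMultilinearMap.map_sum, polyEval, map_sum]
    refine Finset.sum_congr rfl fun r _ => ?_
    rw [ContinuousMultilinearMap.map_smul_univ, map_mul, MvPolynomial.eval_C, map_prod]
    simp [mul_comm]

/-- A smooth function all of whose symmetric differences `v ↦ H (X + v) - H (X - v)` are polynomials
of degree less than a fixed even number `N` in linear coordinates `L v` is a polynomial of degree at
most `N`. -/
theorem exists_mvPolynomial_of_symmDiff {H : EuclideanSpace ℝ ι → ℂ} (hH : ContDiff ℝ ∞ H) {N : ℕ}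
    (hN : Even N) (L : EuclideanSpace ℝ ι →ₗ[ℝ] EuclideanSpace ℝ ι)
    (h : ∀ X, ∃ P : MvPolynomial ι ℂ, P.totalDegree < N ∧
      ∀ v, H (X + v) - H (X - v) = polyEval P (L v)) :
    ∃ p : MvPolynomial ι ℂ, p.totalDegree ≤ N ∧ ∀ X, H X = polyEval p X := by
  choose p hp hpe using fun k => exists_mvPolynomial_iteratedFDeriv k (iteratedFDeriv ℝ k H 0)
  refine ⟨∑ k ∈ Finset.range (N + 1), MvPolynomial.C ((k.factorial : ℝ)⁻¹ : ℂ) * p k, ?_, ?_⟩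
  · refine MvPolynomial.totalDegree_finsetSum_le fun k hk => ?_
    refine (MvPolynomial.totalDegree_mul _ _).trans ?_
    rw [MvPolynomial.totalDegree_C, zero_add]
    exact (hp k).trans (Nat.lt_succ_iff.1 (Finset.mem_range.1 hk))
  intro w
  have hf : ContDiff ℝ ∞ fun t : ℝ => H (t • w) := hH.comp (by fun_prop)
  have hz : iteratedDeriv (N + 1) (fun t : ℝ => H (t • w)) = 0 := by
    refine iteratedDeriv_succ_eq_zero_of_symmDiff hf hN fun s => ?_
    obtain ⟨P, hP, hPe⟩ := h (s • w)
    rw [← iteratedDeriv_polyEval_smul_eq_zero hP (L w)]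
    congr 1
    funext t
    rw [← map_smul, ← hPe, add_smul, sub_smul]
  have := eq_sum_iteratedDeriv_of_iteratedDeriv_succ_eq_zero hf hz
  rw [one_smul] at this
  rw [this, polyEval, map_sum]
  refine Finset.sum_congr rfl fun k _ => ?_
  rw [iteratedDeriv_comp_smul_zero hH, hpe, map_mul, MvPolynomial.eval_C, polyEval]

end Polynomial

/-! ### The truncated bracket as a polynomial on the Fourier side -/

section TruncatedBracket

open scoped FourierTransform LineDeriv

variable {d : ℕ}

lemma hasTemperateGrowth_polyEval {ι : Type*} [Fintype ι] (P : MvPolynomial ι ℂ) :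
    (polyEval P).HasTemperateGrowth := by
  induction P using MvPolynomial.induction_on with
  | C a =>
    have : polyEval (MvPolynomial.C a) = fun _ : EuclideanSpace ℝ ι => a := by
      funext v; simp [polyEval]
    rw [this]
    exact .const a
  | add p q hp hq =>
    have : polyEval (p + q) = polyEval p + polyEval q := by
      funext v; simp [polyEval]
    rw [this]
    exact hp.add hq
  | mul_X p i hp =>
    have : polyEval (p * MvPolynomial.X i) = polyEval p * fun v => ((v i : ℝ) : ℂ) := by
      funext v; simp [polyEval]
    rw [this]
    refine hp.mul ?_
    exact (Complex.ofRealCLM.comp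
      (EuclideanSpace.proj i : EuclideanSpace ℝ ι →L[ℝ] ℝ)).hasTemperateGrowth

/-- The product of a polynomial and a Schwartz function. -/
def polyMul {ι : Type*} [Fintype ι] (P : MvPolynomial ι ℂ) (G : 𝓢(EuclideanSpace ℝ ι, ℂ)) :
    𝓢(EuclideanSpace ℝ ι, ℂ) :=
  SchwartzMap.smulLeftCLM ℂ (polyEval P) G

lemma polyMul_apply {ι : Type*} [Fintype ι] (P : MvPolynomial ι ℂ)
    (G : 𝓢(EuclideanSpace ℝ ι, ℂ)) (v : EuclideanSpace ℝ ι) :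
    polyMul P G v = polyEval P v * G v := by
  rw [polyMul, SchwartzMap.smulLeftCLM_apply_apply (hasTemperateGrowth_polyEval P), smul_eq_mul]

/-- An operator on functions which acts on inverse Fourier transforms of Schwartz functions as the
Fourier multiplier by a polynomial of degree at most `N`. -/
def IsPolyMultiplier (N : ℕ) (T : (Phase d → ℂ) → Phase d → ℂ) : Prop :=
  ∃ P : MvPolynomial (Fin d ⊕ Fin d) ℂ, P.totalDegree ≤ N ∧
    ∀ G : 𝓢(Phase d, ℂ), T (𝓕⁻ G : 𝓢(Phase d, ℂ)) = (𝓕⁻ (polyMul P G) : 𝓢(Phase d, ℂ))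

lemma isPolyMultiplier_id : IsPolyMultiplier (d := d) 0 id := by
  refine ⟨1, by simp, fun G => ?_⟩
  have : polyMul 1 G = G := by
    ext v; simp [polyMul_apply, polyEval]
  rw [this, id]

lemma IsPolyMultiplier.pderiv_comp {N : ℕ} {T : (Phase d → ℂ) → Phase d → ℂ}
    (hT : IsPolyMultiplier N T) (i : Fin d ⊕ Fin d) :
    IsPolyMultiplier (N + 1) (fun f => pderiv i (T f)) := by
  obtain ⟨P, hP, hPT⟩ := hT
  -- Under the convention `e^{2πi⟨v, x⟩}`, `∂_i` corresponds to multiplication by `2πi v_i`.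
  refine ⟨MvPolynomial.C (2 * Real.pi * Complex.I) * (P * MvPolynomial.X i), ?_, fun G => ?_⟩
  · refine (MvPolynomial.totalDegree_mul _ _).trans ?_
    rw [MvPolynomial.totalDegree_C, zero_add]
    refine (MvPolynomial.totalDegree_mul _ _).trans ?_
    rw [MvPolynomial.totalDegree_X]
    omega
  have h := SchwartzMap.lineDerivOp_fourierInv_eq (polyMul P G) (EuclideanSpace.single i (1 : ℝ))
  have h2 : pderiv i (T (𝓕⁻ G : 𝓢(Phase d, ℂ))) =
      (∂_{EuclideanSpace.single i (1 : ℝ)} (𝓕⁻ (polyMul P G)) : 𝓢(Phase d, ℂ)) := by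
    rw [hPT]
    rfl
  refine h2.trans ?_
  rw [h]
  congr 2
  ext v
  have hg : (fun x : Phase d => inner ℝ x (EuclideanSpace.single i (1 : ℝ))).HasTemperateGrowth := by
    fun_prop
  rw [smul_apply, SchwartzMap.smulLeftCLM_apply_apply hg, polyMul_apply, polyMul_apply]
  simp [polyEval, EuclideanSpace.inner_single_right]
  ring

lemma IsPolyMultiplier.iterate_pderiv_comp {N : ℕ} {T : (Phase d → ℂ) → Phase d → ℂ}
    (hT : IsPolyMultiplier N T) (i : Fin d ⊕ Fin d) (n : ℕ) :
    IsPolyMultiplier (N + n) (fun f => (pderiv i)^[n] (T f)) := by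
  induction n with
  | zero => simpa using hT
  | succ n ih => simpa only [Function.iterate_succ_apply'] using! ih.pderiv_comp i

lemma IsPolyMultiplier.foldr_pderiv_comp {N : ℕ} {T : (Phase d → ℂ) → Phase d → ℂ}
    (hT : IsPolyMultiplier N T) (i : Fin d → Fin d ⊕ Fin d) (n : Fin d → ℕ) (l : List (Fin d)) :
    IsPolyMultiplier (N + (l.map n).sum)
      (fun f => l.foldr (fun k g => (pderiv (i k))^[n k] g) (T f)) := by
  induction l with
  | nil => simpa using hT
  | cons k l ih =>
    have := ih.iterate_pderiv_comp (i k) (n k)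
    simpa [add_assoc, add_comm (n k)] using! this

lemma isPolyMultiplier_mderiv (α β : Fin d → ℕ) :
    IsPolyMultiplier (∑ k, β k + ∑ k, α k) (mderiv α β) := by
  have := (isPolyMultiplier_id.foldr_pderiv_comp Sum.inr β (List.finRange d)).foldr_pderiv_comp
    Sum.inl α (List.finRange d)
  simpa [← List.ofFn_eq_map, List.sum_ofFn] using! this

/-- A functional on functions which is given on inverse Fourier transforms of Schwartz functions by
the inverse Fourier transform at `X` of the product with a polynomial of degree at most `N`. -/
def IsPolyFunctional (N : ℕ) (X : Phase d) (L : (Phase d → ℂ) → ℂ) : Prop :=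
  ∃ P : MvPolynomial (Fin d ⊕ Fin d) ℂ, P.totalDegree ≤ N ∧
    ∀ G : 𝓢(Phase d, ℂ), L (𝓕⁻ G : 𝓢(Phase d, ℂ)) = (𝓕⁻ (polyMul P G) : 𝓢(Phase d, ℂ)) X

lemma IsPolyMultiplier.isPolyFunctional {N M : ℕ} {T : (Phase d → ℂ) → Phase d → ℂ}
    (hT : IsPolyMultiplier N T) (hNM : N ≤ M) (X : Phase d) :
    IsPolyFunctional M X (fun f => T f X) := by
  obtain ⟨P, hP, hPT⟩ := hT
  exact ⟨P, hP.trans hNM, fun G => congrFun (hPT G) X⟩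

variable {N : ℕ} {X : Phase d}

lemma IsPolyFunctional.zero : IsPolyFunctional N X (fun _ => 0) := by
  refine ⟨0, by simp, fun G => ?_⟩
  have : polyMul 0 G = 0 := by
    ext v; simp [polyMul_apply, polyEval]
  rw [this, FourierTransform.fourierInv_zero]
  rfl

lemma IsPolyFunctional.add {L M : (Phase d → ℂ) → ℂ} (hL : IsPolyFunctional N X L)
    (hM : IsPolyFunctional N X M) : IsPolyFunctional N X (fun f => L f + M f) := by
  obtain ⟨P, hP, hPL⟩ := hL
  obtain ⟨Q, hQ, hQM⟩ := hM
  refine ⟨P + Q, (MvPolynomial.totalDegree_add _ _).trans (max_le hP hQ), fun G => ?_⟩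
  have : polyMul (P + Q) G = polyMul P G + polyMul Q G := by
    ext v; simp [polyMul_apply, polyEval, add_mul]
  rw [this, FourierTransform.fourierInv_add, add_apply, ← hPL, ← hQM]

lemma IsPolyFunctional.const_mul {L : (Phase d → ℂ) → ℂ} (hL : IsPolyFunctional N X L) (c : ℂ) :
    IsPolyFunctional N X (fun f => c * L f) := by
  obtain ⟨P, hP, hPL⟩ := hL
  refine ⟨MvPolynomial.C c * P, ?_, fun G => ?_⟩
  · refine (MvPolynomial.totalDegree_mul _ _).trans ?_
    rwa [MvPolynomial.totalDegree_C, zero_add]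
  have : polyMul (MvPolynomial.C c * P) G = c • polyMul P G := by
    ext v; simp [polyMul_apply, polyEval, mul_assoc]
  rw [this, FourierTransform.fourierInv_smul, smul_apply, ← hPL, smul_eq_mul]

lemma IsPolyFunctional.mul_const {L : (Phase d → ℂ) → ℂ} (hL : IsPolyFunctional N X L) (c : ℂ) :
    IsPolyFunctional N X (fun f => L f * c) := by
  simpa only [mul_comm c] using hL.const_mul c

lemma IsPolyFunctional.sub {L M : (Phase d → ℂ) → ℂ} (hL : IsPolyFunctional N X L)
    (hM : IsPolyFunctional N X M) : IsPolyFunctional N X (fun f => L f - M f) := by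
  simpa [sub_eq_add_neg] using hL.add (hM.const_mul (-1))

lemma IsPolyFunctional.sum {ι : Type*} {s : Finset ι} {L : ι → (Phase d → ℂ) → ℂ}
    (hL : ∀ i ∈ s, IsPolyFunctional N X (L i)) :
    IsPolyFunctional N X (fun f => ∑ i ∈ s, L i f) := by
  classical
  induction s using Finset.induction_on with
  | empty => simpa using IsPolyFunctional.zero
  | insert a s ha ih =>
    simp only [Finset.sum_insert ha]
    exact (hL a (Finset.mem_insert_self a s)).add
      (ih fun i hi => hL i (Finset.mem_insert_of_mem hi))

lemma isPolyFunctional_pderiv (hN : 1 ≤ N) (i : Fin d ⊕ Fin d) :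
    IsPolyFunctional N X (fun f => pderiv i f X) :=
  (isPolyMultiplier_id.pderiv_comp i).isPolyFunctional (by omega) X

lemma isPolyFunctional_Dderiv {α β : Fin d → ℕ} (h : ∑ k, α k + ∑ k, β k ≤ N) :
    IsPolyFunctional N X (fun f => Dderiv α β f X) :=
  ((isPolyMultiplier_mderiv α β).isPolyFunctional (by omega) X).const_mul _

lemma isPolyFunctional_moyalCoeff_left {j : ℕ} (hj : j ≤ N) (B : Phase d → ℂ) :
    IsPolyFunctional N X (fun A => moyalCoeff j A B X) := by
  refine IsPolyFunctional.const_mul (IsPolyFunctional.sum fun γ hγ => ?_) _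
  refine IsPolyFunctional.const_mul (IsPolyFunctional.mul_const ?_ _) _
  refine isPolyFunctional_Dderiv ?_
  have := (Finset.mem_piAntidiag.1 hγ).1
  rw [Fintype.sum_sum_type] at this
  omega

lemma isPolyFunctional_moyalCoeff_right {j : ℕ} (hj : j ≤ N) (B : Phase d → ℂ) :
    IsPolyFunctional N X (fun A => moyalCoeff j B A X) := by
  refine IsPolyFunctional.const_mul (IsPolyFunctional.sum fun γ hγ => ?_) _
  refine IsPolyFunctional.const_mul (IsPolyFunctional.const_mul ?_ _) _
  refine isPolyFunctional_Dderiv ?_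
  have := (Finset.mem_piAntidiag.1 hγ).1
  rw [Fintype.sum_sum_type] at this
  omega

theorem isPolyFunctional_truncBracket (m : ℕ) (H : Phase d → ℂ) (X : Phase d) :
    IsPolyFunctional (2 * m + 1) X (fun A => truncBracket m A H X) := by
  refine IsPolyFunctional.add (IsPolyFunctional.sum fun k _ => ?_)
    (IsPolyFunctional.sum fun j hj => ?_)
  · exact ((isPolyFunctional_pderiv (by omega) _).mul_const _).sub
      ((isPolyFunctional_pderiv (by omega) _).mul_const _)
  · have hj' := (Finset.mem_Icc.1 hj).2
    exact ((isPolyFunctional_moyalCoeff_left (by omega) H).sub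
      (isPolyFunctional_moyalCoeff_right (by omega) H)).const_mul _

end TruncatedBracket

/-! ### Gaussian regularization and uniform decay of Fourier transforms -/

section Gaussian

open scoped FourierTransform
open MeasureTheory Filter

variable {d : ℕ}

lemma one_add_pow_mul_exp_neg_sq_le {b : ℝ} (hb : 0 < b) (N : ℕ) {t : ℝ} (ht : 0 ≤ t) :
    (1 + t) ^ N * Real.exp (-b * t ^ 2) ≤
      N.factorial * Real.exp (1 + 1 / (2 * b)) * Real.exp (-(b / 2) * t ^ 2) := by
  have h1 : (1 + t) ^ N ≤ N.factorial * Real.exp (1 + t) := by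
    have := Real.pow_div_factorial_le_exp (1 + t) (by positivity) N
    rwa [div_le_iff₀' (by positivity)] at this
  -- Completing the square lets half of the Gaussian absorb the factor `e^t`.
  have h2 : t ≤ 1 / (2 * b) + b / 2 * t ^ 2 := by
    have h3 : 1 / (2 * b) + b / 2 * t ^ 2 - t = (b * t - 1) ^ 2 / (2 * b) := by
      field_simp
      ring
    have h4 : 0 ≤ (b * t - 1) ^ 2 / (2 * b) := by positivity
    linarith
  calc (1 + t) ^ N * Real.exp (-b * t ^ 2)
      ≤ N.factorial * Real.exp (1 + t) * Real.exp (-b * t ^ 2) := by gcongr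
    _ = N.factorial * Real.exp (1 + t + -b * t ^ 2) := by rw [mul_assoc, ← Real.exp_add]
    _ ≤ N.factorial * Real.exp (1 + 1 / (2 * b) + -(b / 2) * t ^ 2) := by
        refine mul_le_mul_of_nonneg_left (Real.exp_le_exp.2 ?_) (by positivity)
        linarith
    _ = _ := by rw [mul_assoc, ← Real.exp_add]

lemma integrable_exp_neg_mul_sq_norm {b : ℝ} (hb : 0 < b) :
    Integrable (fun z : Phase d => Real.exp (-b * ‖z‖ ^ 2)) := by
  have := (GaussianFourier.integrable_cexp_neg_mul_sq_norm_add (b := (b : ℂ)) (by simpa) 0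
    (0 : Phase d)).norm
  refine this.congr (ae_of_all _ fun z => ?_)
  simp only [zero_mul, add_zero, Complex.norm_exp]
  congr 1
  rw [← Complex.ofReal_pow, ← Complex.ofReal_neg, ← Complex.ofReal_mul, Complex.ofReal_re]

lemma integrable_one_add_norm_pow_mul_exp {b : ℝ} (hb : 0 < b) (N : ℕ) :
    Integrable (fun z : Phase d => (1 + ‖z‖) ^ N * Real.exp (-b * ‖z‖ ^ 2)) := by
  refine ((integrable_exp_neg_mul_sq_norm (d := d) (half_pos hb)).const_mul
    (N.factorial * Real.exp (1 + 1 / (2 * b)))).mono'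
    (by fun_prop) (ae_of_all _ fun z => ?_)
  rw [Real.norm_of_nonneg (by positivity)]
  exact one_add_pow_mul_exp_neg_sq_le hb N (norm_nonneg z)

lemma norm_gaussReg {ε : ℝ} (A : Phase d → ℂ) (X : Phase d) :
    ‖gaussReg ε A X‖ = Real.exp (-ε * ‖X‖ ^ 2) * ‖A X‖ := by
  rw [gaussReg, norm_mul, Complex.norm_real, Real.norm_of_nonneg (Real.exp_nonneg _)]

lemma norm_gaussReg_le {ε : ℝ} (hε : 0 ≤ ε) (A : Phase d → ℂ) (X : Phase d) :
    ‖gaussReg ε A X‖ ≤ ‖A X‖ := by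
  rw [norm_gaussReg]
  refine mul_le_of_le_one_left (norm_nonneg _) (Real.exp_le_one_iff.2 ?_)
  have := mul_nonneg hε (sq_nonneg ‖X‖)
  linarith

lemma continuous_gaussReg (ε : ℝ) {A : Phase d → ℂ} (hA : Continuous A) :
    Continuous (gaussReg ε A) := by
  unfold gaussReg
  fun_prop

lemma tendsto_gaussReg (A : Phase d → ℂ) (X : Phase d) :
    Tendsto (fun ε => gaussReg ε A X) (𝓝[>] 0) (𝓝 (A X)) := by
  have : Continuous fun ε : ℝ => gaussReg ε A X := by
    unfold gaussReg
    fun_prop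
  have h := this.tendsto 0
  simp only [gaussReg, neg_zero, zero_mul, Real.exp_zero, Complex.ofReal_one, one_mul] at h
  exact h.mono_left nhdsWithin_le_nhds

lemma integrable_gaussReg {ε : ℝ} (hε : 0 ≤ ε) {A : Phase d → ℂ} (hc : Continuous A)
    (hA : Integrable A) : Integrable (gaussReg ε A) :=
  hA.mono (continuous_gaussReg ε hc).aestronglyMeasurable
    (ae_of_all _ fun X => norm_gaussReg_le hε A X)

/-- The Gaussian regularization of a function of polynomial growth is integrable. -/
lemma integrable_gaussReg_of_growth {ε : ℝ} (hε : 0 < ε) {H : Phase d → ℂ} (hc : Continuous H)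
    {C : ℝ} {M : ℕ} (hH : ∀ X, ‖H X‖ ≤ C * (1 + ‖X‖) ^ M) : Integrable (gaussReg ε H) := by
  refine ((integrable_one_add_norm_pow_mul_exp (d := d) hε M).const_mul C).mono'
    (continuous_gaussReg ε hc).aestronglyMeasurable (ae_of_all _ fun X => ?_)
  rw [norm_gaussReg]
  calc Real.exp (-ε * ‖X‖ ^ 2) * ‖H X‖
      ≤ Real.exp (-ε * ‖X‖ ^ 2) * (C * (1 + ‖X‖) ^ M) := by gcongr; exact hH X
    _ = _ := by ring

/-- The Gaussian is written as a superposition of characters whose weight does not depend on `ε`;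
`ε` enters through the frequency `2√ε z` alone. This is what makes the later bounds uniform as `ε ↘
0`. -/
lemma exp_eq_integral_gaussian {ε : ℝ} (hε : 0 ≤ ε) (y : Phase d) :
    (Real.exp (-ε * ‖y‖ ^ 2) : ℂ) =
      ((Real.pi : ℂ) ^ (Module.finrank ℝ (Phase d) / 2 : ℂ))⁻¹ *
        ∫ z : Phase d, (Real.exp (-1 * ‖z‖ ^ 2) : ℂ) *
          Complex.exp ((2 * √ε * inner ℝ y z : ℝ) * Complex.I) := by
  have h := GaussianFourier.integral_cexp_neg_mul_sq_norm_add (b := 1) (by simp)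
    (2 * (√ε : ℂ) * Complex.I) y
  have h1 : ∀ z : Phase d, Complex.exp (-1 * (‖z‖ : ℂ) ^ 2 +
      2 * (√ε : ℂ) * Complex.I * (inner ℝ y z : ℝ)) = (Real.exp (-1 * ‖z‖ ^ 2) : ℂ) *
          Complex.exp ((2 * √ε * inner ℝ y z : ℝ) * Complex.I) := by
    intro z
    rw [Complex.ofReal_exp, ← Complex.exp_add]
    congr 1
    push_cast
    ring
  simp only [h1] at h
  have hπ : (Real.pi : ℂ) ^ (Module.finrank ℝ (Phase d) / 2 : ℂ) ≠ 0 := by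
    rw [Complex.cpow_ne_zero_iff]
    left
    exact_mod_cast Real.pi_ne_zero
  rw [h, div_one, inv_mul_cancel_left₀ hπ, Complex.ofReal_exp]
  congr 1
  have hs : (√ε : ℂ) ^ 2 = ε := by
    exact_mod_cast congrArg (fun x : ℝ => (x : ℂ)) (Real.sq_sqrt hε)
  rw [mul_pow, mul_pow, hs, Complex.I_sq]
  push_cast
  ring

/-- The Fourier transform of a Gaussian regularization is an average of translates. -/
lemma fourier_gaussReg {ε : ℝ} (hε : 0 ≤ ε) {A : Phase d → ℂ} (hA : Integrable A) (w : Phase d) :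
    𝓕 (gaussReg ε A) w =
      ((Real.pi : ℂ) ^ (Module.finrank ℝ (Phase d) / 2 : ℂ))⁻¹ *
        ∫ z : Phase d, (Real.exp (-1 * ‖z‖ ^ 2) : ℂ) * 𝓕 A (w - (√ε / Real.pi) • z) := by
  have hexp : Integrable (fun z : Phase d => (Real.exp (-1 * ‖z‖ ^ 2) : ℂ)) :=
    (integrable_exp_neg_mul_sq_norm one_pos).ofReal
  have hint : Integrable (Function.uncurry fun (y z : Phase d) =>
      Complex.exp ((-2 * Real.pi * inner ℝ y w + 2 * √ε * inner ℝ y z : ℝ) * Complex.I) *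
        (A y * (Real.exp (-1 * ‖z‖ ^ 2) : ℂ))) (volume.prod volume) := by
    refine (hA.mul_prod hexp).bdd_mul (c := 1) (Continuous.aestronglyMeasurable ?_)
      (ae_of_all _ fun p => ?_)
    · fun_prop
    · rw [Complex.norm_exp_ofReal_mul_I]
  calc 𝓕 (gaussReg ε A) w
      = ∫ y, Complex.exp ((-2 * Real.pi * inner ℝ y w : ℝ) * Complex.I) *
          ((((Real.pi : ℂ) ^ (Module.finrank ℝ (Phase d) / 2 : ℂ))⁻¹ *
        ∫ z : Phase d, (Real.exp (-1 * ‖z‖ ^ 2) : ℂ) *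
          Complex.exp ((2 * √ε * inner ℝ y z : ℝ) * Complex.I)) * A y) := by
        rw [Real.fourier_eq']
        simp only [gaussReg, smul_eq_mul, exp_eq_integral_gaussian hε]
    _ = ((Real.pi : ℂ) ^ (Module.finrank ℝ (Phase d) / 2 : ℂ))⁻¹ * ∫ y, ∫ z,
          Complex.exp ((-2 * Real.pi * inner ℝ y w + 2 * √ε * inner ℝ y z : ℝ) * Complex.I) *
          (A y * (Real.exp (-1 * ‖z‖ ^ 2) : ℂ)) := by
        rw [← integral_const_mul]
        congr 1
        funext y
        rw [mul_left_comm (Complex.exp _), mul_assoc (((Real.pi : ℂ) ^ _)⁻¹)]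
        refine congrArg _ ?_
        rw [← integral_mul_const]
        congr 1
        funext z
        rw [Complex.ofReal_add, add_mul, Complex.exp_add]
        ring
    _ = ((Real.pi : ℂ) ^ (Module.finrank ℝ (Phase d) / 2 : ℂ))⁻¹ * ∫ z, ∫ y,
          Complex.exp ((-2 * Real.pi * inner ℝ y w + 2 * √ε * inner ℝ y z : ℝ) * Complex.I) *
          (A y * (Real.exp (-1 * ‖z‖ ^ 2) : ℂ)) := by
        rw [integral_integral_swap hint]
    _ = _ := by
        congr 1
        congr 1
        funext z
        rw [Real.fourier_eq', ← integral_const_mul]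
        congr 1
        funext y
        have : -2 * Real.pi * inner ℝ y (w - (√ε / Real.pi) • z) =
            -2 * Real.pi * inner ℝ y w + 2 * √ε * inner ℝ y z := by
          rw [inner_sub_right, inner_smul_right]
          field_simp
          ring
        rw [this, smul_eq_mul]
        ring

/-- The Fourier transforms of the regularizations `e^{-ε|X|²} A`, `0 < ε ≤ 1`, of a Schwartz function
decay rapidly, uniformly in `ε`. -/
lemma exists_fourier_gaussReg_bound (A : 𝓢(Phase d, ℂ)) (N : ℕ) :
    ∃ K : ℝ, ∀ ε ∈ Set.Ioc (0 : ℝ) 1, ∀ w, (1 + ‖w‖) ^ N * ‖𝓕 (gaussReg ε A) w‖ ≤ K := by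
  obtain ⟨C, hC⟩ : ∃ C : ℝ, ∀ w, (1 + ‖w‖) ^ N * ‖𝓕 (A : Phase d → ℂ) w‖ ≤ C := by
    refine ⟨2 ^ N * ((Finset.Iic (N, 0)).sup fun m => SchwartzMap.seminorm ℝ m.1 m.2) (𝓕 A),
      fun w => ?_⟩
    have := SchwartzMap.one_add_le_sup_seminorm_apply (𝕜 := ℝ) (m := (N, 0)) le_rfl le_rfl (𝓕 A) w
    rwa [norm_iteratedFDeriv_zero] at this
  refine ⟨‖((Real.pi : ℂ) ^ (Module.finrank ℝ (Phase d) / 2 : ℂ))⁻¹‖ *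
    ∫ z : Phase d, C * ((1 + ‖z‖) ^ N * Real.exp (-1 * ‖z‖ ^ 2)), fun ε hε w => ?_⟩
  rw [fourier_gaussReg hε.1.le A.integrable, norm_mul, mul_left_comm]
  refine mul_le_mul_of_nonneg_left ?_ (norm_nonneg _)
  have hnn : 0 ≤ (1 + ‖w‖) ^ N := by positivity
  rw [← Real.norm_of_nonneg hnn, ← Complex.norm_real, ← norm_mul, ← integral_const_mul]
  refine norm_integral_le_of_norm_le
    ((integrable_one_add_norm_pow_mul_exp one_pos N).const_mul C) (ae_of_all _ fun z => ?_)
  rw [norm_mul, norm_mul, Complex.norm_real, Complex.norm_real, Real.norm_of_nonneg hnn,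
    Real.norm_of_nonneg (Real.exp_nonneg _)]
  set h : ℝ := √ε / Real.pi with hh
  have hh0 : 0 ≤ h := by positivity
  have hh1 : h ≤ 1 := by
    rw [hh, div_le_one Real.pi_pos]
    exact (Real.sqrt_le_one.2 hε.2).trans (by linarith [Real.pi_gt_three])
  -- Peetre-type inequality: the weight moves onto the translate of `𝓕 A`, at the cost of a power of
  -- `1 + ‖z‖` that the Gaussian absorbs. The shift satisfies `h ≤ 1` because `ε ≤ 1`.
  have hw : 1 + ‖w‖ ≤ (1 + ‖w - h • z‖) * (1 + ‖z‖) := by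
    have h1 : ‖w‖ ≤ ‖w - h • z‖ + ‖h • z‖ := by
      simpa using norm_add_le (w - h • z) (h • z)
    have h2 : ‖h • z‖ ≤ ‖z‖ := by
      rw [norm_smul, Real.norm_of_nonneg hh0]
      exact mul_le_of_le_one_left (norm_nonneg z) hh1
    nlinarith [mul_nonneg (norm_nonneg (w - h • z)) (norm_nonneg z)]
  calc (1 + ‖w‖) ^ N * (Real.exp (-1 * ‖z‖ ^ 2) * ‖𝓕 (A : Phase d → ℂ) (w - h • z)‖)
      ≤ ((1 + ‖w - h • z‖) * (1 + ‖z‖)) ^ N *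
          (Real.exp (-1 * ‖z‖ ^ 2) * ‖𝓕 (A : Phase d → ℂ) (w - h • z)‖) := by gcongr
    _ = ((1 + ‖w - h • z‖) ^ N * ‖𝓕 (A : Phase d → ℂ) (w - h • z)‖) *
          ((1 + ‖z‖) ^ N * Real.exp (-1 * ‖z‖ ^ 2)) := by
        rw [mul_pow]
        ring
    _ ≤ C * ((1 + ‖z‖) ^ N * Real.exp (-1 * ‖z‖ ^ 2)) := by
        gcongr
        exact hC _

lemma tendsto_fourier_gaussReg {A : Phase d → ℂ} (hc : Continuous A) (hA : Integrable A)
    (w : Phase d) :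
    Tendsto (fun ε => 𝓕 (gaussReg ε A) w) (𝓝[>] 0) (𝓝 (𝓕 A w)) := by
  simp only [Real.fourier_eq', smul_eq_mul]
  refine tendsto_integral_filter_of_dominated_convergence (fun y => ‖A y‖) ?_ ?_ hA.norm ?_
  · refine Eventually.of_forall fun ε => Continuous.aestronglyMeasurable ?_
    have := continuous_gaussReg ε hc
    fun_prop
  · filter_upwards [self_mem_nhdsWithin] with ε hε
    refine ae_of_all _ fun y => ?_
    rw [norm_mul, Complex.norm_exp_ofReal_mul_I, one_mul]
    exact norm_gaussReg_le (le_of_lt hε) A y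
  · exact ae_of_all _ fun y => (tendsto_gaussReg A y).const_mul _

lemma continuous_fourier_of_integrable {A : Phase d → ℂ} (hA : Integrable A) :
    Continuous (𝓕 A) :=
  VectorFourier.fourierIntegral_continuous Real.continuous_fourierChar
    (by exact continuous_inner) hA

end Gaussian

/-! ### The Moyal bracket with a Schwartz function as a single integral -/

section MoyalProduct

open scoped FourierTransform
open MeasureTheory Filter

variable {d : ℕ}

/-- The linear isometry `J` of phase space with `σ(u, v) = ⟪u, J v⟫`. -/
def sympRot : Phase d ≃ₗᵢ[ℝ] Phase d where
  toFun v := WithLp.toLp 2 (Sum.elim (fun k => -v (Sum.inr k)) (fun k => v (Sum.inl k)))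
  invFun v := WithLp.toLp 2 (Sum.elim (fun k => v (Sum.inr k)) (fun k => -v (Sum.inl k)))
  map_add' u v := by
    ext i
    rcases i with i | i <;> simp [add_comm]
  map_smul' c v := by
    ext i
    rcases i with i | i <;> simp
  left_inv v := by
    ext i
    rcases i with i | i <;> simp
  right_inv v := by
    ext i
    rcases i with i | i <;> simp
  norm_map' v := by
    simp [EuclideanSpace.norm_eq, Fintype.sum_sum_type, add_comm]

lemma inner_sympRot (u v : Phase d) : inner ℝ u (sympRot v) = symp u v := by
  have h : ∀ w : Phase d, inner ℝ u w = ∑ i, w i * u i := fun w => by simp [PiLp.inner_apply]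
  rw [h, Fintype.sum_sum_type, symp, ← Finset.sum_add_distrib]
  refine Finset.sum_congr rfl fun k _ => ?_
  simp [sympRot]
  ring

lemma symp_swap (u v : Phase d) : symp v u = -symp u v := by
  simp only [symp, ← Finset.sum_neg_distrib, neg_sub]

lemma symp_add_left (u u' v : Phase d) : symp (u + u') v = symp u v + symp u' v := by
  simp only [← inner_sympRot, inner_add_left]

lemma symp_neg_right (u v : Phase d) : symp u (-v) = -symp u v := by
  simp only [← inner_sympRot, map_neg, inner_neg_right]

lemma continuous_symp : Continuous fun p : Phase d × Phase d => symp p.1 p.2 := by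
  simp only [← inner_sympRot]
  have := (sympRot (d := d)).continuous
  fun_prop

/-- The twisted convolution integral `∫∫ e^{-2isσ(u,v)} A(X+u) B(X+v) du dv`. -/
def twistedIntegral (s : ℝ) (A B : Phase d → ℂ) (X : Phase d) : ℂ :=
  ∫ p : Phase d × Phase d,
    Complex.exp ((-2 * s * symp p.1 p.2 : ℝ) * Complex.I) * (A (X + p.1) * B (X + p.2))

lemma moyalIntegral_eq_twistedIntegral (A B : Phase d → ℂ) (X : Phase d) :
    moyalIntegral A B X = ((Real.pi : ℂ) ^ (2 * d))⁻¹ * twistedIntegral 1 A B X := by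
  unfold moyalIntegral twistedIntegral
  congr 2
  funext p
  rw [mul_assoc]
  congr 2
  push_cast
  ring

/-- Exchanging `u` and `v` reverses the sign of `σ`, so both orders of the product are treated
together, with `s = ±1`. -/
lemma moyalIntegral_swap_eq_twistedIntegral (A B : Phase d → ℂ) (X : Phase d) :
    moyalIntegral B A X = ((Real.pi : ℂ) ^ (2 * d))⁻¹ * twistedIntegral (-1) A B X := by
  unfold moyalIntegral twistedIntegral
  congr 1
  rw [Measure.volume_eq_prod, ← integral_prod_swap]
  congr 1
  funext p
  rw [Prod.fst_swap, Prod.snd_swap, symp_swap p.1 p.2, mul_assoc, mul_comm (A _)]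
  congr 2
  push_cast
  ring

/-- The integrand of the Moyal product after the integration over the Schwartz factor. -/
def moyalKernel (s : ℝ) (A B : Phase d → ℂ) (X v : Phase d) : ℂ :=
  Complex.exp ((2 * s * symp X v : ℝ) * Complex.I) * 𝓕 A ((s / Real.pi) • sympRot v) * B (X + v)

lemma integral_exp_symp_mul (s : ℝ) (A : Phase d → ℂ) (X v : Phase d) :
    ∫ u, Complex.exp ((-2 * s * symp u v : ℝ) * Complex.I) * A (X + u) =
      Complex.exp ((2 * s * symp X v : ℝ) * Complex.I) * 𝓕 A ((s / Real.pi) • sympRot v) := by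
  rw [Real.fourier_eq', ← integral_const_mul]
  refine Eq.trans ?_ (integral_add_left_eq_self _ X)
  congr 1
  funext u
  rw [smul_eq_mul, ← mul_assoc, ← Complex.exp_add, inner_smul_right, inner_sympRot,
    symp_add_left]
  congr 2
  have hπ : (Real.pi : ℂ) ≠ 0 := by exact_mod_cast Real.pi_ne_zero
  push_cast
  field_simp
  ring

lemma twistedIntegral_eq (s : ℝ) {A B : Phase d → ℂ} (hA : Integrable A)
    (hB : Integrable B) (X : Phase d) :
    twistedIntegral s A B X = ∫ v, moyalKernel s A B X v := by
  have hint : Integrable (fun p : Phase d × Phase d =>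
      Complex.exp ((-2 * s * symp p.1 p.2 : ℝ) * Complex.I) * (A (X + p.1) * B (X + p.2)))
      (volume.prod volume) := by
    refine ((hA.comp_add_left X).mul_prod (hB.comp_add_left X)).bdd_mul (c := 1)
      (Continuous.aestronglyMeasurable ?_) (ae_of_all _ fun p => ?_)
    · have := continuous_symp (d := d)
      fun_prop
    · rw [Complex.norm_exp_ofReal_mul_I]
  rw [twistedIntegral, Measure.volume_eq_prod, integral_prod_symm _ hint]
  congr 1
  funext v
  rw [moyalKernel, ← integral_exp_symp_mul, ← integral_mul_const]
  simp only [mul_assoc]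

variable {s : ℝ} {H : Phase d → ℂ} {C : ℝ} {M : ℕ}

/-- Of the powers of decay of `𝓕 A`, `M` compensate the growth of `B` and the remaining `dim + 1`
give integrability. The bound depends on `A` and `B` only through `K`, `C` and `M`, so it dominates
the regularized kernels uniformly in `ε`. -/
lemma norm_moyalKernel_le (hs : |s| = 1) {A B : Phase d → ℂ} {K : ℝ}
    (hA : ∀ w, (1 + ‖w‖) ^ (M + (Module.finrank ℝ (Phase d) + 1)) * ‖𝓕 A w‖ ≤ K)
    (hB : ∀ X, ‖B X‖ ≤ C * (1 + ‖X‖) ^ M) (X v : Phase d) :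
    ‖moyalKernel s A B X v‖ ≤
      K * Real.pi ^ (M + (Module.finrank ℝ (Phase d) + 1)) * (C * (1 + ‖X‖) ^ M) *
        (1 + ‖v‖) ^ (-((Module.finrank ℝ (Phase d) : ℝ) + 1)) := by
  set n := Module.finrank ℝ (Phase d)
  have hC : 0 ≤ C := by
    have := (norm_nonneg _).trans (hB 0)
    simpa using this
  have hK : 0 ≤ K := le_trans (by positivity) (hA 0)
  set w := (s / Real.pi) • sympRot v with hw
  have hwn : ‖w‖ = ‖v‖ / Real.pi := by
    rw [hw, norm_smul, norm_div, Real.norm_eq_abs, hs, Real.norm_of_nonneg Real.pi_pos.le,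
      LinearIsometryEquiv.norm_map]
    ring
  have h1 : (1 + ‖v‖) ≤ Real.pi * (1 + ‖w‖) := by
    rw [hwn, mul_add, mul_div_cancel₀ _ Real.pi_ne_zero]
    linarith [Real.pi_gt_three]
  have h2 : (1 + ‖v‖) ^ (M + (n + 1)) * ‖𝓕 A w‖ ≤ K * Real.pi ^ (M + (n + 1)) := by
    calc (1 + ‖v‖) ^ (M + (n + 1)) * ‖𝓕 A w‖
        ≤ (Real.pi * (1 + ‖w‖)) ^ (M + (n + 1)) * ‖𝓕 A w‖ := by gcongr
      _ = ((1 + ‖w‖) ^ (M + (n + 1)) * ‖𝓕 A w‖) * Real.pi ^ (M + (n + 1)) := by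
          rw [mul_pow]
          ring
      _ ≤ K * Real.pi ^ (M + (n + 1)) := by
          gcongr
          exact hA w
  have h3 : ‖B (X + v)‖ ≤ C * (1 + ‖X‖) ^ M * (1 + ‖v‖) ^ M := by
    refine (hB _).trans ?_
    rw [mul_assoc, ← mul_pow]
    gcongr
    nlinarith [norm_add_le X v, mul_nonneg (norm_nonneg X) (norm_nonneg v)]
  have hpos : 0 < 1 + ‖v‖ := by positivity
  have h4 : (1 + ‖v‖) ^ (-((n : ℝ) + 1)) = ((1 + ‖v‖) ^ (n + 1))⁻¹ := by
    rw [Real.rpow_neg hpos.le]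
    norm_cast
  rw [moyalKernel, norm_mul, norm_mul, Complex.norm_exp_ofReal_mul_I, one_mul, h4,
    ← div_eq_mul_inv, le_div_iff₀ (by positivity)]
  calc ‖𝓕 A w‖ * ‖B (X + v)‖ * (1 + ‖v‖) ^ (n + 1)
      ≤ ‖𝓕 A w‖ * (C * (1 + ‖X‖) ^ M * (1 + ‖v‖) ^ M) * (1 + ‖v‖) ^ (n + 1) := by gcongr
    _ = ((1 + ‖v‖) ^ (M + (n + 1)) * ‖𝓕 A w‖) * (C * (1 + ‖X‖) ^ M) := by ring
    _ ≤ _ := by gcongr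

lemma continuous_moyalKernel (s : ℝ) {A B : Phase d → ℂ} (hA : Integrable A) (hB : Continuous B)
    (X : Phase d) : Continuous (moyalKernel s A B X) := by
  have h1 := continuous_fourier_of_integrable hA
  have h2 := (sympRot (d := d)).continuous
  have h3 : Continuous fun v => symp X v := continuous_symp.comp (Continuous.prodMk_right X)
  unfold moyalKernel
  fun_prop

lemma integrable_one_add_norm_rpow :
    Integrable fun v : Phase d => (1 + ‖v‖) ^ (-((Module.finrank ℝ (Phase d) : ℝ) + 1)) :=
  integrable_one_add_norm (by linarith)

lemma integrable_moyalKernel (hs : |s| = 1) (A : 𝓢(Phase d, ℂ)) (hc : Continuous H)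
    (hH : ∀ X, ‖H X‖ ≤ C * (1 + ‖X‖) ^ M) (X : Phase d) :
    Integrable (moyalKernel s A H X) := by
  obtain ⟨K, hK⟩ := exists_fourier_gaussReg_bound A (M + (Module.finrank ℝ (Phase d) + 1))
  have hA : ∀ w, (1 + ‖w‖) ^ (M + (Module.finrank ℝ (Phase d) + 1)) *
      ‖𝓕 (A : Phase d → ℂ) w‖ ≤ K := by
    intro w
    have := ((tendsto_fourier_gaussReg A.continuous A.integrable w).norm).const_mul
      ((1 + ‖w‖) ^ (M + (Module.finrank ℝ (Phase d) + 1)))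
    -- The bound uniform in `ε` passes to the limit `ε ↘ 0`.
    refine le_of_tendsto this ?_
    filter_upwards [Ioc_mem_nhdsGT one_pos] with ε hε using hK ε hε w
  exact (integrable_one_add_norm_rpow.const_mul _).mono'
    (continuous_moyalKernel s A.integrable hc X).aestronglyMeasurable
    (ae_of_all _ fun v => norm_moyalKernel_le hs hA hH X v)

lemma tendsto_twistedIntegral_gaussReg (hs : |s| = 1) (A : 𝓢(Phase d, ℂ)) (hc : Continuous H)
    (hH : ∀ X, ‖H X‖ ≤ C * (1 + ‖X‖) ^ M) (X : Phase d) :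
    Tendsto (fun ε => twistedIntegral s (gaussReg ε A) (gaussReg ε H) X) (𝓝[>] 0)
      (𝓝 (∫ v, moyalKernel s A H X v)) := by
  obtain ⟨K, hK⟩ := exists_fourier_gaussReg_bound A (M + (Module.finrank ℝ (Phase d) + 1))
  have hpos : ∀ᶠ ε in 𝓝[>] (0 : ℝ), ε ∈ Set.Ioc (0 : ℝ) 1 := Ioc_mem_nhdsGT one_pos
  have hlim : Tendsto (fun ε => ∫ v, moyalKernel s (gaussReg ε A) (gaussReg ε H) X v) (𝓝[>] 0)
      (𝓝 (∫ v, moyalKernel s A H X v)) := by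
    refine tendsto_integral_filter_of_dominated_convergence _ ?_ ?_
      (integrable_one_add_norm_rpow.const_mul
        (K * Real.pi ^ (M + (Module.finrank ℝ (Phase d) + 1)) * (C * (1 + ‖X‖) ^ M))) ?_
    · filter_upwards [hpos] with ε hε
      exact (continuous_moyalKernel s
        (integrable_gaussReg hε.1.le A.continuous A.integrable)
        (continuous_gaussReg ε hc) X).aestronglyMeasurable
    · filter_upwards [hpos] with ε hε
      exact ae_of_all _ fun v => norm_moyalKernel_le hs (hK ε hε)
        (fun Y => (norm_gaussReg_le hε.1.le H Y).trans (hH Y)) X v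
    · refine ae_of_all _ fun v => ?_
      exact ((tendsto_fourier_gaussReg A.continuous A.integrable _).const_mul _).mul
        (tendsto_gaussReg H (X + v))
  refine hlim.congr' ?_
  filter_upwards [hpos] with ε hε
  exact (twistedIntegral_eq s (integrable_gaussReg hε.1.le A.continuous A.integrable)
    (integrable_gaussReg_of_growth hε.1 hc hH) X).symm

/-- The Moyal bracket of a Schwartz function with a continuous function of polynomial growth. -/
theorem moyalBracket_eq_integral (A : 𝓢(Phase d, ℂ)) (hc : Continuous H)
    (hH : ∀ X, ‖H X‖ ≤ C * (1 + ‖X‖) ^ M) (X : Phase d) :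
    moyalBracket A H X = Complex.I * (((Real.pi : ℂ) ^ (2 * d))⁻¹ *
      ∫ v, Complex.exp ((2 * symp X v : ℝ) * Complex.I) *
        𝓕 (A : Phase d → ℂ) ((1 / Real.pi) • sympRot v) * (H (X + v) - H (X - v))) := by
  have h1 : moyalProd A H X = ((Real.pi : ℂ) ^ (2 * d))⁻¹ * ∫ v, moyalKernel 1 A H X v := by
    -- `limUnder` has this value only because the regularized integrals are shown to converge.
    refine Tendsto.limUnder_eq ?_
    simp only [moyalIntegral_eq_twistedIntegral]
    exact (tendsto_twistedIntegral_gaussReg abs_one A hc hH X).const_mul _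
  have h2 : moyalProd H A X = ((Real.pi : ℂ) ^ (2 * d))⁻¹ * ∫ v, moyalKernel (-1) A H X v := by
    refine Tendsto.limUnder_eq ?_
    simp only [moyalIntegral_swap_eq_twistedIntegral]
    exact (tendsto_twistedIntegral_gaussReg (by simp) A hc hH X).const_mul _
  have hi1 := integrable_moyalKernel abs_one A hc hH X
  -- Under `v ↦ -v` the kernel for `s = -1` acquires the phase and the argument of `𝓕 A` of the
  -- kernel for `s = 1`, so only the values of `H` differ.
  have hi2 := (integrable_moyalKernel (s := -1) (by simp) A hc hH X).comp_neg
  rw [moyalBracket, h1, h2, ← integral_neg_eq_self (moyalKernel (-1) A H X), ← mul_sub,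
    ← integral_sub hi1 hi2]
  congr 3
  funext v
  have h3 : (-1 / Real.pi) • sympRot (-v) = (1 / Real.pi) • sympRot v := by
    rw [map_neg, smul_neg, ← neg_smul]
    congr 1
    ring
  have h4 : 2 * -1 * -symp X v = 2 * symp X v := by ring
  rw [moyalKernel, moyalKernel, h3, symp_neg_right, h4, mul_one, mul_sub, ← sub_eq_add_neg]

end MoyalProduct

/-! ### Comparing the brackets on the Fourier side -/

section PolynomialHamiltonian

open scoped FourierTransform
open MeasureTheory Filter

variable {d : ℕ}

lemma mderiv_zero (f : Phase d → ℂ) : mderiv (fun _ => 0) (fun _ => 0) f = f := by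
  have h : ∀ (i : Fin d → Fin d ⊕ Fin d) (l : List (Fin d)) (g : Phase d → ℂ),
      l.foldr (fun k g => (pderiv (i k))^[0] g) g = g := by
    intro i l g
    induction l with
    | nil => rfl
    | cons k l ih => simp
  rw [mderiv, h, h]

lemma IsSymbol.exists_growth {μ δ : ℝ} {H : Phase d → ℂ} (hH : IsSymbol μ δ H) :
    ∃ (C : ℝ) (M : ℕ), ∀ X, ‖H X‖ ≤ C * (1 + ‖X‖) ^ M := by
  obtain ⟨C, hC⟩ := hH.2 (fun _ => 0) (fun _ => 0)
  obtain ⟨M, hM⟩ := exists_nat_ge μ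
  refine ⟨|C|, M, fun X => ?_⟩
  have h := hC X
  simp only [mderiv_zero, Finset.sum_const_zero, add_zero, Nat.cast_zero, mul_zero] at h
  have h1 : 1 ≤ √(1 + ‖X‖ ^ 2) := Real.one_le_sqrt.2 (by nlinarith [sq_nonneg ‖X‖])
  have h2 : √(1 + ‖X‖ ^ 2) ≤ 1 + ‖X‖ :=
    Real.sqrt_le_iff.2 ⟨by positivity, by nlinarith [norm_nonneg X]⟩
  calc ‖H X‖ ≤ C * √(1 + ‖X‖ ^ 2) ^ μ := h
    _ ≤ |C| * √(1 + ‖X‖ ^ 2) ^ μ := by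
        gcongr
        exact le_abs_self C
    _ ≤ |C| * √(1 + ‖X‖ ^ 2) ^ (M : ℝ) := by
        gcongr
    _ ≤ |C| * (1 + ‖X‖) ^ M := by
        rw [Real.rpow_natCast]
        gcongr

/-- The rotation preserves volume and the dilation by `1/π` has Jacobian `π^{-2d}`. This is the
normalization of the Moyal product, so the constants on the two sides cancel. -/
lemma integral_eq_integral_smul_sympRot (f : Phase d → ℂ) :
    ∫ w, f w = ((Real.pi : ℂ) ^ (2 * d))⁻¹ * ∫ v, f ((1 / Real.pi) • sympRot v) := by
  have hn : Module.finrank ℝ (Phase d) = 2 * d := by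
    rw [finrank_euclideanSpace, Fintype.card_sum, Fintype.card_fin, two_mul]
  have h1 := (sympRot (d := d)).measurePreserving.integral_comp
    (sympRot (d := d)).toHomeomorph.measurableEmbedding (fun w => f ((1 / Real.pi) • w))
  have hπ : (Real.pi : ℂ) ^ (2 * d) ≠ 0 := pow_ne_zero _ (by exact_mod_cast Real.pi_ne_zero)
  rw [h1, Measure.integral_comp_smul, hn, abs_of_pos (by positivity), Complex.real_smul]
  simp [hπ]

/-- If the Moyal bracket of `H` with every Schwartz function is a differential operator of order at
most `N` at the point `X`, then the symmetric difference of `H` at `X` is a polynomial. -/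
lemma exists_symmDiff_eq_polyEval {H : Phase d → ℂ} (hc : Continuous H) {C : ℝ} {M : ℕ}
    (hH : ∀ X, ‖H X‖ ≤ C * (1 + ‖X‖) ^ M) {N : ℕ} {X : Phase d} {L : (Phase d → ℂ) → ℂ}
    (hL : IsPolyFunctional N X L) (hbr : ∀ A : 𝓢(Phase d, ℂ), L A = moyalBracket A H X) :
    ∃ P : MvPolynomial (Fin d ⊕ Fin d) ℂ, P.totalDegree ≤ N ∧
      ∀ v, H (X + v) - H (X - v) = polyEval P ((1 / Real.pi) • sympRot v) := by
  obtain ⟨P, hP, hPL⟩ := hL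
  set J : Phase d → Phase d := fun v => (1 / Real.pi) • sympRot v with hJ
  have hJc : Continuous J := by
    have := (sympRot (d := d)).continuous
    fun_prop
  set E : Phase d → ℂ := fun v => Complex.exp ((2 * symp X v : ℝ) * Complex.I) with hE
  have hEc : Continuous E := by
    have : Continuous fun v => symp X v := continuous_symp.comp (Continuous.prodMk_right X)
    fun_prop
  set F : Phase d → ℂ := fun v =>
    E v * (polyEval P (J v) - Complex.I * (H (X + v) - H (X - v))) with hF
  have hFc : Continuous F := by
    have := continuous_polyEval P
    fun_prop
  have hzero : ∀ᵐ v, F v = 0 := by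
    refine ae_eq_zero_of_integral_contDiff_smul_eq_zero hFc.locallyIntegrable fun g hg hgs => ?_
    -- `e` is the inverse of `J`. Taking `A = 𝓕⁻ G` with `G = g ∘ e` gives `𝓕 A (J v) = g v`, so the
    -- bracket identity says that `F` integrates to zero against `g`.
    let e : Phase d ≃L[ℝ] Phase d :=
      (ContinuousLinearEquiv.smulLeft (Units.mk0 Real.pi Real.pi_ne_zero)).trans
        sympRot.symm.toContinuousLinearEquiv
    have heJ : ∀ v, e (J v) = v := by
      intro v
      change sympRot.symm (Real.pi • ((1 / Real.pi) • sympRot v)) = v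
      rw [smul_smul, mul_one_div_cancel Real.pi_ne_zero, one_smul,
        LinearIsometryEquiv.symm_apply_apply]
    have hGs : HasCompactSupport fun w => (g (e w) : ℂ) :=
      (hgs.comp_homeomorph e.toHomeomorph).comp_left (g := fun x : ℝ => (x : ℂ)) Complex.ofReal_zero
    have hGd : ContDiff ℝ ∞ fun w => (g (e w) : ℂ) :=
      Complex.ofRealCLM.contDiff.comp (hg.comp e.contDiff)
    let G : 𝓢(Phase d, ℂ) := hGs.toSchwartzMap hGd
    have hGJ : ∀ v, G (J v) = (g v : ℂ) := by
      intro v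
      change (g (e (J v)) : ℂ) = g v
      rw [heJ]
    have hfour : 𝓕 ((𝓕⁻ G : 𝓢(Phase d, ℂ)) : Phase d → ℂ) = G := by
      rw [← SchwartzMap.fourier_coe, FourierTransform.fourier_fourierInv_eq]
    have h1 := hbr (𝓕⁻ G)
    rw [hPL, moyalBracket_eq_integral _ hc hH, hfour, SchwartzMap.fourierInv_coe,
      Real.fourierInv_eq', integral_eq_integral_smul_sympRot, mul_left_comm] at h1
    have hπ : ((Real.pi : ℂ) ^ (2 * d))⁻¹ ≠ 0 :=
      inv_ne_zero (pow_ne_zero _ (by exact_mod_cast Real.pi_ne_zero))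
    have h2 := mul_left_cancel₀ hπ h1
    rw [← integral_const_mul, ← sub_eq_zero] at h2
    have hgc : Continuous fun v => (g v : ℂ) := Complex.continuous_ofReal.comp hg.continuous
    have hgcs : HasCompactSupport fun v => (g v : ℂ) :=
      hgs.comp_left (g := fun x : ℝ => (x : ℂ)) Complex.ofReal_zero
    have e1 : (fun v => Complex.exp ((2 * Real.pi * inner ℝ ((1 / Real.pi) • sympRot v) X : ℝ) *
        Complex.I) • polyMul P G ((1 / Real.pi) • sympRot v)) =
        fun v => (g v : ℂ) * (E v * polyEval P (J v)) := by
      funext v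
      have : 2 * Real.pi * inner ℝ ((1 / Real.pi) • sympRot v) X = 2 * symp X v := by
        rw [real_inner_comm, inner_smul_right, inner_sympRot]
        field_simp
      rw [this, polyMul_apply]
      change E v • (polyEval P (J v) * G (J v)) = _
      rw [hGJ, smul_eq_mul]
      ring
    have e2 : (fun v => Complex.I * (Complex.exp ((2 * symp X v : ℝ) * Complex.I) *
        G ((1 / Real.pi) • sympRot v) * (H (X + v) - H (X - v)))) =
        fun v => (g v : ℂ) * (E v * (Complex.I * (H (X + v) - H (X - v)))) := by
      funext v
      change Complex.I * (E v * G (J v) * (H (X + v) - H (X - v))) = _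
      rw [hGJ]
      ring
    have hPc := continuous_polyEval P
    rw [e1, e2, ← integral_sub] at h2
    · rw [← h2]
      congr 1
      funext v
      rw [hF, Complex.real_smul]
      ring
    · exact (Continuous.mul hgc (by fun_prop)).integrable_of_hasCompactSupport hgcs.mul_right
    · exact (Continuous.mul hgc (by fun_prop)).integrable_of_hasCompactSupport hgcs.mul_right
  -- `F` is continuous and Lebesgue measure charges open sets, so vanishing almost everywhere is
  -- vanishing everywhere.
  have hF0 : F = fun _ => 0 := (hFc.ae_eq_iff_eq volume continuous_const).1 hzero
  refine ⟨MvPolynomial.C (-Complex.I) * P, ?_, fun v => ?_⟩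
  · refine (MvPolynomial.totalDegree_mul _ _).trans ?_
    rwa [MvPolynomial.totalDegree_C, zero_add]
  · have h := (mul_eq_zero.1 (congrFun hF0 v)).resolve_left (Complex.exp_ne_zero _)
    rw [polyEval, map_mul, MvPolynomial.eval_C]
    change _ = -Complex.I * polyEval P (J v)
    rw [sub_eq_zero.1 h, ← mul_assoc, neg_mul, Complex.I_mul_I, neg_neg, one_mul]

end PolynomialHamiltonian

end Moyal

end

theorem theorem2 (d m : ℕ) (μ δ : ℝ) (hδ : δ < 1 / 2)
    (H : Moyal.Phase d → ℂ) (hH : Moyal.IsSymbol μ δ H)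
    (hbr : ∀ A : 𝓢(Moyal.Phase d, ℂ), ∀ X : Moyal.Phase d,
      Moyal.truncBracket m A H X = Moyal.moyalBracket A H X) :
    ∃ p : MvPolynomial (Fin d ⊕ Fin d) ℂ, p.totalDegree ≤ 2 * m + 2 ∧
      ∀ X : Moyal.Phase d, H X = MvPolynomial.eval (fun i => (X i : ℂ)) p := by
  obtain ⟨C, M, hgrowth⟩ := hH.exists_growth
  -- The symmetric differences have degree at most `2m+1`, and `2m+2` is the next integer, which is
  -- even as the symmetry argument requires.
  refine Moyal.exists_mvPolynomial_of_symmDiff hH.1 (N := 2 * m + 2) ⟨m + 1, by ring⟩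
    ((1 / Real.pi) • (Moyal.sympRot (d := d)).toLinearEquiv.toLinearMap) fun X => ?_
  obtain ⟨P, hP, hPe⟩ := Moyal.exists_symmDiff_eq_polyEval hH.1.continuous hgrowth
    (Moyal.isPolyFunctional_truncBracket m H X) (fun A => hbr A X)
  exact ⟨P, Nat.lt_succ_of_le hP, hPe⟩
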